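/- Let $N\in\mathbb N$ and $0<\delta\le 1/1000$. There is $\eta>0$, depending only on $N$ and $\delta$, such that for every $\gamma\in(0,1)$ there is $C>0$, depending only on $N,\delta,\gamma$, for which the following holds. Let $(X,d)$ be a metric space in which every open ball of radius $\rho>0$ can be covered by at most $N$ open balls of radius $\rho/2$. *Dyadic systems.* Let points $x^k_\alpha\in X$ be given ($k\in\mathbb Z$, $\alpha$ in a set of indices $I_k\subseteq\mathbb N$) with $d(x^k_\alpha,x^k_\beta)\ge\delta^k/8$ for $\alpha\ne\beta$ and such that for every $x\in X$ and $k$ some $\alpha\in I_k$ has $d(x,x^k_\alpha)<4\delta^k$. Every $(k,\alpha)$ gets one parent $(k-1,\beta)$: the (unique) one with $d(x^k_\alpha,x^{k-1}_\beta)<\delta^{k-1}/16$ if it exists, and otherwise any one with $d(x^k_\alpha,x^{k-1}_\beta)<4\delta^{k-1}$. Let $\le$ be the reflexive and transitive closure of the relation "$(k,\alpha)\le$ its parent", and let $\overline Q{}^k_\alpha$ be the closure of $\bigcup_{(\ell,\beta)\le(k,\alpha)}B(x^\ell_\beta,\delta^\ell/100)$. The (half-open) dyadic cubes $Q^k_\alpha$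 are as follows. For $k=0$, $Q^0_\alpha=\overline Q{}^0_\alpha\setminus\bigcup_{\beta<\alpha}\overline Q{}^0_\beta$. For $k<0$, $Q^k_\alpha=\bigcup_{(0,\beta)\le(k,\alpha)}Q^0_\beta$. For $k>0$, if $(k-1,\sigma)$ is the parent of $(k,\alpha)$, then $Q^k_\alpha=(Q^{k-1}_\sigma\cap\overline Q{}^k_\alpha)\setminus\bigcup_\beta\overline Q{}^k_\beta$, the union being over the $\beta<\alpha$ for which $(k,\beta)$ has the same parent $(k-1,\sigma)$. Put $\ell(Q^k_\alpha)=\delta^k$. Let $\mathcal D$ be a fixed dyadic system, that is, the cubes of one such family of points and parents. *The random system $\mathcal D'$.* For each $k\in\mathbb Z$ fix a maximal collection of points $z^k_\alpha$ (again with indices in a subset of $\mathbb N$) such that $d(z^k_\alpha,z^k_\beta)\ge\delta^k$ for $\alpha\ne\beta$, and give every $(k,\alpha)$ one parent $(k-1,\beta)$: the one with $d(z^k_\alpha,z^{k-1}_\beta)<\delta^{k-1}/2$ if it exists, and otherwise any one with $d(z^k_\alpha,z^{k-1}_\beta)<\delta^{k-1}$. For each $(k,\alpha)$ choose one of its (finitely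 many, at least one) children $(k+1,\beta)$ at random with the uniform distribution, independently for different $(k,\alpha)$, and put $y^k_\alpha=z^{k+1}_\beta$. In each generation $k$ go through the points $y^k_\alpha$ in the order of their indices and keep $y^k_\alpha$ if and only if $d(y^k_\alpha,y^k_\beta)\ge\delta^k/4$ for all $\beta<\alpha$ for which $y^k_\beta$ was kept. The kept points are the centers of $\mathcal D'$. Parents for them are chosen by the rule of dyadic systems above, where a free choice of the parent of a point of generation $k$ may depend, measurably, on the random choices in the generations $\ge k-1$ but not on those in generations $<k-1$. Let $\mathcal D'$ be the resulting system of half-open cubes. *Bad cubes.* For $r\in\mathbb N$, a cube $Q\in\mathcal D$ is good if every $R\in\mathcal D'$ with $\ell(Q)\le\delta^r\ell(R)$ satisfies $$d(Q,R)\ge\ell(Q)^\gamma\ell(R)^{1-\gamma}\quad\text{or}\quad d(Q,X\setminus R)\ge\ell(Q)^\gamma\ell(R)^{1-\gamma}$$ (with $d(A,\emptyset)=\infty$), and bad otherwise. Then for every $r\in\mathbb N=\{0,1,2,\dots\}$ and every fixed cube $Q^k_\alpha\in\mathcal D$, $$\mathbb P\big(Q^k_\alpha\text{ is bad}\big)\le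 C\,\delta^{r\gamma\eta}.$$ -/

import Mathlib

open MeasureTheory ProbabilityTheory

universe u

/-- Every open ball of radius `r` is covered by at most `N` open balls of radius `r / 2`. -/
def GeometricallyDoubling (X : Type u) [MetricSpace X] (N : ℕ) : Prop :=
  ∀ (x : X) (r : ℝ), 0 < r →
    ∃ s : Finset X, s.card ≤ N ∧ Metric.ball x r ⊆ ⋃ y ∈ s, Metric.ball y (r / 2)

/-- The distance between two sets; it is `⊤` when one of them is empty. -/
noncomputable def setEDist {X : Type u} [MetricSpace X] (A B : Set X) : ENNReal :=
  ⨅ a ∈ A, ⨅ b ∈ B, edist a b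

/-- For every generation `k ∈ ℤ` a collection of points `ctr k α`, enumerated by the indices
`α ∈ idx k ⊆ ℕ`, together with a map which sends the index `α` of a point of generation `k` to
the index `par k α` of a point of generation `k - 1`. (Values at `α ∉ idx k` are irrelevant.) -/
structure PointSystem (X : Type u) where
  idx : ℤ → Set ℕ
  ctr : ℤ → ℕ → X
  par : ℤ → ℕ → ℕ

namespace PointSystem

variable {X : Type u} [MetricSpace X]

/-- The rule for choosing parents: if there is a point of generation `k - 1` at distance less than
`near * δ ^ (k - 1)` from `ctr k α`, then it is the parent of `(k, α)`; otherwise the parent is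
any point of generation `k - 1` at distance less than `far * δ ^ (k - 1)`. -/
structure IsParentRule (S : PointSystem X) (near far δ : ℝ) : Prop where
  mem : ∀ k, ∀ α ∈ S.idx k, S.par k α ∈ S.idx (k - 1)
  dist_lt : ∀ k, ∀ α ∈ S.idx k,
    dist (S.ctr k α) (S.ctr (k - 1) (S.par k α)) < far * δ ^ (k - 1)
  eq_of_near : ∀ k, ∀ α ∈ S.idx k, ∀ β ∈ S.idx (k - 1),
    dist (S.ctr k α) (S.ctr (k - 1) β) < near * δ ^ (k - 1) → S.par k α = β

/-- `S.Below (ℓ, β) (k, α)` is the order relation `(ℓ, β) ≤ (k, α)`: the reflexive and transitive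
closure of `(k, α) ≤ (k - 1, par k α)`. -/
def Below (S : PointSystem X) : ℤ × ℕ → ℤ × ℕ → Prop :=
  Relation.ReflTransGen fun a b => a.2 ∈ S.idx a.1 ∧ b = (a.1 - 1, S.par a.1 a.2)

/-- The points and the order relation from which dyadic cubes are built. -/
structure IsDyadicSystem (S : PointSystem X) (δ : ℝ) : Prop where
  separated : ∀ k, ∀ α ∈ S.idx k, ∀ β ∈ S.idx k, α ≠ β →
    δ ^ k / 8 ≤ dist (S.ctr k α) (S.ctr k β)
  covers : ∀ k x, ∃ α ∈ S.idx k, dist x (S.ctr k α) < 4 * δ ^ k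
  parents : S.IsParentRule (1 / 16) 4 δ

/-- The closure of the open Christ cube
`⋃ {B(x^ℓ_β, δ^ℓ / 100) : (ℓ, β) ≤ (k, α)}`. -/
def closedCube (S : PointSystem X) (δ : ℝ) (k : ℤ) (α : ℕ) : Set X :=
  closure (⋃ (b : ℤ × ℕ) (_ : b.2 ∈ S.idx b.1 ∧ S.Below b (k, α)),
    Metric.ball (S.ctr b.1 b.2) (δ ^ b.1 / 100))

/-- Half-open cubes of generations `0, 1, 2, …`. In generation `0` each closed cube loses the
closed cubes with smaller index (equivalently, the half-open cubes with smaller index). In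
generation `n + 1` the same is done with the children of each half-open cube of generation `n`,
inside that cube. -/
def halfOpenCubeNat (S : PointSystem X) (δ : ℝ) : ℕ → ℕ → Set X
  | 0, α => S.closedCube δ 0 α \ ⋃ β ∈ {β | β ∈ S.idx 0 ∧ β < α}, S.closedCube δ 0 β
  | n + 1, α =>
      (S.halfOpenCubeNat δ n (S.par (n + 1) α) ∩ S.closedCube δ (n + 1) α) \
        ⋃ β ∈ {β | β ∈ S.idx (n + 1) ∧ β < α ∧ S.par (n + 1) β = S.par (n + 1) α},
          S.closedCube δ (n + 1) β

/-- The half-open dyadic cube with index `α` of generation `k`. For `k < 0` it is the union of the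
half-open cubes of generation `0` below it. -/
def cube (S : PointSystem X) (δ : ℝ) : ℤ → ℕ → Set X
  | Int.ofNat n, α => S.halfOpenCubeNat δ n α
  | Int.negSucc n, α =>
      ⋃ β ∈ {β | β ∈ S.idx 0 ∧ S.Below (0, β) (Int.negSucc n, α)}, S.halfOpenCubeNat δ 0 β

/-- The cube `Q = D.cube δ k α`, of side length `ℓ(Q) = δ ^ k`, is good with respect to the
cubes `R = D'.cube δ m β`, of side length `ℓ(R) = δ ^ m`. -/
def IsGood (D D' : PointSystem X) (δ γ : ℝ) (r : ℕ) (k : ℤ) (α : ℕ) : Prop :=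
  ∀ m, ∀ β ∈ D'.idx m, δ ^ k ≤ δ ^ r * δ ^ m →
    ENNReal.ofReal ((δ ^ k) ^ γ * (δ ^ m) ^ (1 - γ)) ≤
        setEDist (D.cube δ k α) (D'.cube δ m β) ∨
    ENNReal.ofReal ((δ ^ k) ^ γ * (δ ^ m) ^ (1 - γ)) ≤
        setEDist (D.cube δ k α) (D'.cube δ m β)ᶜ

def IsBad (D D' : PointSystem X) (δ γ : ℝ) (r : ℕ) (k : ℤ) (α : ℕ) : Prop :=
  ¬ D.IsGood D' δ γ r k α

/-- A reference system: in every generation a maximal `δ ^ k`-separated collection of points (no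
further point can be added), with an order relation. -/
structure IsReferenceSystem (S : PointSystem X) (δ : ℝ) : Prop where
  separated : ∀ k, ∀ α ∈ S.idx k, ∀ β ∈ S.idx k, α ≠ β →
    δ ^ k ≤ dist (S.ctr k α) (S.ctr k β)
  maximal : ∀ k x, ∃ α ∈ S.idx k, dist x (S.ctr k α) < δ ^ k
  parents : S.IsParentRule (1 / 2) 1 δ

/-- The pairs `(k, α)` which label a point. -/
abbrev Node (S : PointSystem X) : Type := {a : ℤ × ℕ // a.2 ∈ S.idx a.1}

/-- The indices `β` with `(k + 1, β) ≤ (k, α)`, for `a = (k, α)`. -/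
abbrev Child (S : PointSystem X) (a : S.Node) : Type :=
  {β : ℕ // β ∈ S.idx (a.1.1 + 1) ∧ S.par (a.1.1 + 1) β = a.1.2}

/-- The family of all relations `↘`: for every pair `(k, α)` one child `(k + 1, β)` is picked. -/
abbrev Choice (S : PointSystem X) : Type := (a : S.Node) → S.Child a

theorem child_nonempty {S : PointSystem X} {δ : ℝ} (h₀ : 0 < δ) (h₁ : δ ≤ 1 / 1000)
    (hS : S.IsReferenceSystem δ) (a : S.Node) : Nonempty (S.Child a) := by
  obtain ⟨⟨k, α⟩, ha⟩ := a
  obtain ⟨β, hβ, hd⟩ := hS.maximal (k + 1) (S.ctr k α)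
  refine ⟨⟨β, hβ, ?_⟩⟩
  have hk : (0 : ℝ) < δ ^ k := zpow_pos h₀ k
  have e : δ ^ (k + 1) = δ ^ k * δ := zpow_add_one₀ h₀.ne' k
  have hα : α ∈ S.idx (k + 1 - 1) := by simpa using ha
  refine hS.parents.eq_of_near (k + 1) β hβ α hα ?_
  rw [add_sub_cancel_right, dist_comm]
  nlinarith

theorem ball_cover {N : ℕ} (hX : GeometricallyDoubling X N) (x : X) (r : ℝ) (hr : 0 < r) (n : ℕ) :
    ∃ s : Finset X, Metric.ball x r ⊆ ⋃ y ∈ s, Metric.ball y (r / 2 ^ n) := by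
  classical
  induction n with
  | zero => exact ⟨{x}, by simp⟩
  | succ n ih =>
    obtain ⟨s, hs⟩ := ih
    choose t _ ht using fun y : X => hX y (r / 2 ^ n) (by positivity)
    refine ⟨s.biUnion t, fun w hw => ?_⟩
    obtain ⟨y, hy, hwy⟩ := Set.mem_iUnion₂.1 (hs hw)
    obtain ⟨v, hv, hwv⟩ := Set.mem_iUnion₂.1 (ht y hwy)
    refine Set.mem_iUnion₂.2 ⟨v, Finset.mem_biUnion.2 ⟨y, hy, hv⟩, ?_⟩
    rwa [pow_succ, ← div_div]

theorem child_finite {S : PointSystem X} {δ : ℝ} {N : ℕ} (hX : GeometricallyDoubling X N)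
    (h₀ : 0 < δ) (hS : S.IsReferenceSystem δ) (a : S.Node) : Finite (S.Child a) := by
  obtain ⟨⟨k, α⟩, ha⟩ := a
  have hk : (0 : ℝ) < δ ^ k := zpow_pos h₀ k
  have hk' : (0 : ℝ) < δ ^ (k + 1) := zpow_pos h₀ _
  obtain ⟨n, hn⟩ := pow_unbounded_of_one_lt (2 * δ ^ k / δ ^ (k + 1)) (one_lt_two (α := ℝ))
  obtain ⟨s, hs⟩ := ball_cover hX (S.ctr k α) (δ ^ k) hk n
  have hsmall : 2 * (δ ^ k / 2 ^ n) < δ ^ (k + 1) := by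
    rw [div_lt_iff₀ hk'] at hn
    rw [← mul_div_assoc, div_lt_iff₀ (by positivity)]
    linarith
  have key : ∀ b : S.Child ⟨(k, α), ha⟩,
      ∃ y : s, dist (S.ctr (k + 1) b.1) y < δ ^ k / 2 ^ n := by
    rintro ⟨β, hβ, hp⟩
    have h := hS.parents.dist_lt (k + 1) β hβ
    dsimp only at hp
    rw [hp, add_sub_cancel_right, one_mul] at h
    obtain ⟨y, hy, hd⟩ := Set.mem_iUnion₂.1 (hs (Metric.mem_ball.2 h))
    exact ⟨⟨y, hy⟩, hd⟩
  choose f hf using key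
  refine Finite.of_injective f fun b c hbc => ?_
  by_contra hne
  have h1 := hS.separated (k + 1) b.1 b.2.1 c.1 c.2.1 (fun h => hne (Subtype.ext h))
  have h2 := hf b
  have h3 := hf c
  rw [← hbc] at h3
  have h4 := dist_triangle_right (S.ctr (k + 1) b.1) (S.ctr (k + 1) c.1) (f b : X)
  linarith

/-- The probability on the relations `↘`: the children of different pairs are picked independently
of each other, and each of them uniformly among the finitely many possibilities. -/
noncomputable def choiceLaw {S : PointSystem X} {δ : ℝ} {N : ℕ} (hX : GeometricallyDoubling X N)
    (h₀ : 0 < δ) (h₁ : δ ≤ 1 / 1000) (hS : S.IsReferenceSystem δ) : Measure S.Choice :=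
  haveI : ∀ a, Finite (S.Child a) := child_finite hX h₀ hS
  haveI : ∀ a, Nonempty (S.Child a) := child_nonempty h₀ h₁ hS
  haveI : ∀ a, IsProbabilityMeasure (uniformOn (Set.univ : Set (S.Child a))) := fun _ =>
    isProbabilityMeasure_uniformOn Set.finite_univ Set.univ_nonempty
  Measure.infinitePi fun a => uniformOn (Set.univ : Set (S.Child a))

open Classical in
/-- The point `y^k_α = z^{k+1}_β`, where `(k, α) ↘ (k + 1, β)`. -/
noncomputable def newPoint (S : PointSystem X) (ω : S.Choice) (k : ℤ) (α : ℕ) : X :=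
  if h : α ∈ S.idx k then S.ctr (k + 1) (ω ⟨(k, α), h⟩) else S.ctr k α

/-- The removal procedure: going through the points `y^k_α` in the order of their indices, `y^k_α`
is kept if and only if it is not in conflict with a point that was kept before. -/
def Survives (S : PointSystem X) (δ : ℝ) (ω : S.Choice) (k : ℤ) (α : ℕ) : Prop :=
  α ∈ S.idx k ∧ ∀ β, ∀ _ : β < α, S.Survives δ ω k β →
    ¬ dist (S.newPoint ω k β) (S.newPoint ω k α) < δ ^ k / 4
termination_by α

/-- The new points which survive the removal procedure, with parents given by `p`. -/
noncomputable def randomSystem (S : PointSystem X) (δ : ℝ) (ω : S.Choice) (p : ℤ → ℕ → ℕ) :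
    PointSystem X where
  idx k := {α | S.Survives δ ω k α}
  ctr := S.newPoint ω
  par := p

/-- An admissible way `p` of choosing the parents of the random points. For every `ω` the rule of
dyadic systems is obeyed, and the choice of the parent of `(k, α)`, which is a point of generation
`k - 1`, is a measurable function of the relation `↘` on the generations `≥ k - 1` (which determine
all the random points of generations `≥ k - 1`). -/
structure IsParentChoice (S : PointSystem X) (δ : ℝ) (p : S.Choice → ℤ → ℕ → ℕ) : Prop where
  rule : ∀ ω, (S.randomSystem δ ω (p ω)).IsParentRule (1 / 16) 4 δ
  adapted : ∀ k α, Measurable[⨆ (a : S.Node) (_ : k - 1 ≤ a.1.1),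
    MeasurableSpace.comap (fun ω : S.Choice => ω a) inferInstance] fun ω => p ω k α

end PointSystem

/-!
Let `Q` be the fixed cube, of generation `k`, and let `x` be its center. The proof compares `Q`
with the cubes of one generation `m ≤ k - r` of the random system at a time.

Suppose that in some generation `j ≥ m` a surviving random center lies within `δ ^ (j + 1)` of `x`.
Every point of generation `j + 1` whose cube meets `B(x, δ ^ (j + 1))` is then so close to this
center that it must be its child. So the whole ball lies in one cube of generation `j`
(`PointSystem.ball_subset_cube`) and, cubes being nested, in one cube of generation `m`. Every
cube `R` of generation `m` contains the ball or misses it, so that `Q` is good with respect to `R`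
as long as `δ ^ (j + 1)` is larger than `6 * δ ^ (k * γ + m * (1 - γ))`
(`PointSystem.good_at_of_near_center`). This leaves about `(k - m) * γ` generations `j`.

In each generation `j`, such a center exists with probability at least some `q > 0` which depends
only on `N` and `δ`: it is enough that boundedly many points of generation `j` near `x` pick a
prescribed child (`PointSystem.exists_favorable_choice`). These events only involve choices made in
generation `j`, so they are independent for different `j`, and they do not depend on how parents
are chosen. Hence all of them fail with probability at most about `(1 - q) ^ ((k - m) * γ)`
(`PointSystem.choiceLaw_no_near_center_le`). With `1 - q = δ ^ η`, the sum over `m ≤ k - r` is a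
geometric series, comparable to its first term `δ ^ (r * γ * η)`
(`PointSystem.choiceLaw_isBad_le`).
-/

/-! ### Counting points in doubling spaces -/

theorem GeometricallyDoubling.exists_cover_card_le {X : Type u} [MetricSpace X] {N : ℕ}
    (hX : GeometricallyDoubling X N) (x : X) {r : ℝ} (hr : 0 < r) (n : ℕ) :
    ∃ s : Finset X, s.card ≤ N ^ n ∧ Metric.ball x r ⊆ ⋃ y ∈ s, Metric.ball y (r / 2 ^ n) := by
  classical
  induction n with
  | zero => exact ⟨{x}, by simp, by simp⟩
  | succ n ih =>
    obtain ⟨s, hsc, hs⟩ := ih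
    choose t htc ht using fun y : X => hX y (r / 2 ^ n) (by positivity)
    refine ⟨s.biUnion t, ?_, fun w hw => ?_⟩
    · rw [pow_succ]
      exact (Finset.card_biUnion_le_card_mul s t N fun y _ => htc y).trans
        (Nat.mul_le_mul_right N hsc)
    · obtain ⟨y, hy, hwy⟩ := Set.mem_iUnion₂.1 (hs hw)
      obtain ⟨v, hv, hwv⟩ := Set.mem_iUnion₂.1 (ht y hwy)
      refine Set.mem_iUnion₂.2 ⟨v, Finset.mem_biUnion.2 ⟨y, hy, hv⟩, ?_⟩
      rwa [pow_succ, ← div_div]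

/-- A separated family inside a ball is finite, with a bound on its cardinality which depends
only on the doubling constant and the ratio of the two scales. -/
theorem GeometricallyDoubling.finite_and_ncard_le {X : Type u} [MetricSpace X] {N : ℕ}
    (hX : GeometricallyDoubling X N) {ι : Type*} (f : ι → X) (T : Set ι) (x : X) {R s : ℝ} (n : ℕ)
    (hR : 0 < R) (hs : 2 * R ≤ s * 2 ^ n)
    (hsep : ∀ i ∈ T, ∀ j ∈ T, i ≠ j → s ≤ dist (f i) (f j))
    (hT : ∀ i ∈ T, dist (f i) x < R) : T.Finite ∧ T.ncard ≤ N ^ n := by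
  obtain ⟨t, htc, ht⟩ := hX.exists_cover_card_le x hR n
  have key : ∀ i : ι, ∃ y : X, i ∈ T → y ∈ t ∧ dist (f i) y < R / 2 ^ n := by
    intro i
    by_cases hi : i ∈ T
    · obtain ⟨y, hy, hd⟩ := Set.mem_iUnion₂.1 (ht (Metric.mem_ball.2 (hT i hi)))
      exact ⟨y, fun _ => ⟨hy, hd⟩⟩
    · exact ⟨x, fun h => absurd h hi⟩
  choose g hg using key
  have hinj : Set.InjOn g T := by
    intro i hi j hj hij
    by_contra hne
    have h1 := hsep i hi j hj hne
    have h2 := (hg i hi).2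
    have h3 := (hg j hj).2
    rw [← hij] at h3
    have h4 := dist_triangle_right (f i) (f j) (g i)
    have h5 : s < 2 * R / 2 ^ n := by rw [mul_div_assoc]; linarith
    rw [lt_div_iff₀ (by positivity)] at h5
    linarith
  have hmaps : Set.MapsTo g T (t : Set X) := fun i hi => (hg i hi).1
  refine ⟨Set.Finite.of_injOn hmaps hinj t.finite_toSet, ?_⟩
  have := Set.ncard_le_ncard_of_injOn g hmaps hinj t.finite_toSet
  rw [Set.ncard_coe_finset] at this
  exact this.trans htc

namespace PointSystem

variable {X : Type u}

/-! ### The order relation on the points of a system -/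

theorem Below.gen_le {S : PointSystem X} {a b : ℤ × ℕ} (h : S.Below b a) : a.1 ≤ b.1 := by
  induction h with
  | refl => exact le_rfl
  | tail _ h ih =>
    obtain ⟨-, rfl⟩ := h
    dsimp only
    omega

theorem below_par {S : PointSystem X} {k : ℤ} {α : ℕ} (h : α ∈ S.idx k) :
    S.Below (k, α) (k - 1, S.par k α) :=
  Relation.ReflTransGen.single ⟨h, rfl⟩

theorem Below.eq_of_gen_le {S : PointSystem X} {a b : ℤ × ℕ} (h : S.Below b a)
    (hg : b.1 ≤ a.1) : b = a := by
  rcases Relation.ReflTransGen.cases_tail h with h | ⟨c, hc, -, h⟩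
  · exact h.symm
  · have := Below.gen_le hc
    rw [h] at hg
    dsimp only at hg
    omega

/-- Ancestors are determined by their generation. -/
theorem Below.unique {S : PointSystem X} {a a' b : ℤ × ℕ} (h : S.Below b a) (h' : S.Below b a')
    (hg : a.1 = a'.1) : a = a' := by
  have hU : Relator.RightUnique fun a b : ℤ × ℕ =>
      a.2 ∈ S.idx a.1 ∧ b = (a.1 - 1, S.par a.1 a.2) := by
    rintro a b c ⟨-, rfl⟩ ⟨-, rfl⟩
    rfl
  rcases Relation.ReflTransGen.total_of_right_unique hU h h' with h | h
  · exact Below.eq_of_gen_le h hg.le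
  · exact (Below.eq_of_gen_le h hg.ge).symm

variable [MetricSpace X]

theorem exists_ancestor {S : PointSystem X} {near far δ : ℝ} (hS : S.IsParentRule near far δ)
    {l : ℤ} {β : ℕ} (hβ : β ∈ S.idx l) {k : ℤ} (hk : k ≤ l) :
    ∃ α ∈ S.idx k, S.Below (l, β) (k, α) := by
  induction k, hk using Int.leInductionDown with
  | base => exact ⟨β, hβ, .refl⟩
  | pred k _ ih =>
    obtain ⟨α, hα, h⟩ := ih
    exact ⟨_, hS.mem k α hα, h.trans (below_par hα)⟩

/-- The distances to successive ancestors form a geometric series. -/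
theorem Below.dist_le {S : PointSystem X} {near δ : ℝ} (h₀ : 0 < δ) (h₁ : δ ≤ 1 / 1000)
    (hS : S.IsParentRule near 4 δ) {a b : ℤ × ℕ} (h : S.Below b a) :
    dist (S.ctr b.1 b.2) (S.ctr a.1 a.2) ≤ 5 * (δ ^ a.1 - δ ^ b.1) := by
  induction h with
  | refl => simp
  | @tail c d _ h ih =>
    obtain ⟨h, rfl⟩ := h
    dsimp only
    have h2 := hS.dist_lt _ _ h
    have h3 := dist_triangle (S.ctr b.1 b.2) (S.ctr c.1 c.2) (S.ctr (c.1 - 1) (S.par c.1 c.2))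
    have e : δ ^ c.1 = δ ^ (c.1 - 1) * δ := by rw [← zpow_add_one₀ h₀.ne', sub_add_cancel]
    have hp : (0 : ℝ) < δ ^ (c.1 - 1) := zpow_pos h₀ _
    nlinarith

/-! ### Closed cubes -/

/-- The open Christ cube, whose closure is `closedCube`. -/
def openCube (S : PointSystem X) (δ : ℝ) (k : ℤ) (α : ℕ) : Set X :=
  ⋃ (b : ℤ × ℕ) (_ : b.2 ∈ S.idx b.1 ∧ S.Below b (k, α)),
    Metric.ball (S.ctr b.1 b.2) (δ ^ b.1 / 100)

theorem mem_openCube {S : PointSystem X} {δ : ℝ} {k : ℤ} {α : ℕ} {x : X} :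
    x ∈ S.openCube δ k α ↔ ∃ b : ℤ × ℕ, (b.2 ∈ S.idx b.1 ∧ S.Below b (k, α)) ∧
      dist x (S.ctr b.1 b.2) < δ ^ b.1 / 100 := by
  simp only [openCube, Set.mem_iUnion, Metric.mem_ball, exists_prop]

theorem closedCube_mono {S : PointSystem X} (δ : ℝ) {k l : ℤ} {α β : ℕ}
    (h : S.Below (l, β) (k, α)) : S.closedCube δ l β ⊆ S.closedCube δ k α := by
  refine closure_mono fun x hx => ?_
  obtain ⟨b, ⟨hb, hb'⟩, hd⟩ := mem_openCube.1 hx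
  exact mem_openCube.2 ⟨b, ⟨hb, hb'.trans h⟩, hd⟩

theorem dist_le_of_mem_closedCube {S : PointSystem X} {near δ : ℝ} (h₀ : 0 < δ)
    (h₁ : δ ≤ 1 / 1000) (hS : S.IsParentRule near 4 δ) {k : ℤ} {α : ℕ} {x : X}
    (hx : x ∈ S.closedCube δ k α) : dist x (S.ctr k α) ≤ 5 * δ ^ k := by
  have : S.closedCube δ k α ⊆ Metric.closedBall (S.ctr k α) (5 * δ ^ k) := by
    refine closure_minimal (fun x hx => ?_) Metric.isClosed_closedBall
    obtain ⟨b, ⟨hb, hb'⟩, hd⟩ := mem_openCube.1 hx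
    have h := Below.dist_le h₀ h₁ hS hb'
    have hp : (0 : ℝ) < δ ^ b.1 := zpow_pos h₀ _
    rw [Metric.mem_closedBall]
    have h3 := dist_triangle x (S.ctr b.1 b.2) (S.ctr k α)
    dsimp only at h
    linarith
  exact this hx

theorem exists_gen_zpow_lt {δ : ℝ} (h₀ : 0 < δ) (h₁ : δ ≤ 1 / 1000) (k : ℤ) {ε : ℝ}
    (hε : 0 < ε) : ∃ l, k ≤ l ∧ δ ^ l < ε := by
  obtain ⟨n, hn⟩ := exists_pow_lt_of_lt_one (y := δ) (div_pos hε (zpow_pos h₀ k))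
    (by linarith)
  refine ⟨k + n, by omega, ?_⟩
  rw [lt_div_iff₀ (zpow_pos h₀ k)] at hn
  rwa [zpow_add₀ h₀.ne', zpow_natCast, mul_comm]

/-- The closed cubes of every generation cover the space: only finitely many of them come close to
a given point, and together their open parts approach it. -/
theorem exists_mem_closedCube {N : ℕ} (hX : GeometricallyDoubling X N) {S : PointSystem X}
    {δ : ℝ} (h₀ : 0 < δ) (h₁ : δ ≤ 1 / 1000) (hS : S.IsDyadicSystem δ) (k : ℤ) (x : X) :
    ∃ α ∈ S.idx k, x ∈ S.closedCube δ k α := by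
  have hk : (0 : ℝ) < δ ^ k := zpow_pos h₀ k
  let A : Set ℕ := {α | α ∈ S.idx k ∧ dist (S.ctr k α) x < 10 * δ ^ k}
  have hA : A.Finite := (hX.finite_and_ncard_le (S.ctr k) A x (R := 10 * δ ^ k) (s := δ ^ k / 8) 8
    (by positivity) (by linarith) (fun i hi j hj => hS.separated k i hi.1 j hj.1)
    fun i hi => hi.2).1
  have hx : x ∈ closure (⋃ α ∈ A, S.openCube δ k α) := by
    rw [Metric.mem_closure_iff]
    intro ε hε
    obtain ⟨l, hl, hlt⟩ := exists_gen_zpow_lt h₀ h₁ k (ε := min (ε / 4) (δ ^ k))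
      (lt_min (by linarith) hk)
    obtain ⟨β, hβ, hd⟩ := hS.covers l x
    obtain ⟨α, hα, hb⟩ := exists_ancestor hS.parents hβ hl
    have h1 := hlt.trans_le (min_le_left _ _)
    have h2 := hlt.trans_le (min_le_right _ _)
    have h3 := Below.dist_le h₀ h₁ hS.parents hb
    have hlp : (0 : ℝ) < δ ^ l := zpow_pos h₀ l
    refine ⟨S.ctr l β, Set.mem_iUnion₂.2 ⟨α, ⟨hα, ?_⟩, mem_openCube.2 ⟨(l, β), ⟨hβ, hb⟩, ?_⟩⟩, ?_⟩
    · have h4 := dist_triangle_left (S.ctr k α) x (S.ctr l β)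
      rw [dist_comm x] at hd
      dsimp only at h3
      linarith
    · rw [dist_self]; positivity
    · linarith
  rw [hA.closure_biUnion] at hx
  obtain ⟨α, hα, h⟩ := Set.mem_iUnion₂.1 hx
  exact ⟨α, hα.1, h⟩

/-- A closed cube is the union of the closed cubes of its children. -/
theorem exists_child_mem_closedCube {N : ℕ} (hX : GeometricallyDoubling X N) {S : PointSystem X}
    {δ : ℝ} (h₀ : 0 < δ) (h₁ : δ ≤ 1 / 1000) (hS : S.IsDyadicSystem δ) {k : ℤ} {σ : ℕ}
    (hσ : σ ∈ S.idx k) {x : X} (hx : x ∈ S.closedCube δ k σ) :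
    ∃ α ∈ S.idx (k + 1), S.par (k + 1) α = σ ∧ x ∈ S.closedCube δ (k + 1) α := by
  have hk : (0 : ℝ) < δ ^ k := zpow_pos h₀ k
  have hk' : (0 : ℝ) < δ ^ (k + 1) := zpow_pos h₀ _
  have e : δ ^ (k + 1) = δ ^ k * δ := zpow_add_one₀ h₀.ne' k
  let A : Set ℕ := {α | α ∈ S.idx (k + 1) ∧ S.par (k + 1) α = σ}
  obtain ⟨n, hn⟩ := pow_unbounded_of_one_lt (2 * (4 * δ ^ k) / (δ ^ (k + 1) / 8))
    (one_lt_two (α := ℝ))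
  rw [div_lt_iff₀' (by positivity)] at hn
  have hA : A.Finite := by
    refine (hX.finite_and_ncard_le (S.ctr (k + 1)) A (S.ctr k σ) (R := 4 * δ ^ k)
      (s := δ ^ (k + 1) / 8) n (by positivity) hn.le
      (fun i hi j hj => hS.separated _ i hi.1 j hj.1) fun i hi => ?_).1
    have := hS.parents.dist_lt _ i hi.1
    rwa [hi.2, add_sub_cancel_right] at this
  have hsub : S.openCube δ k σ ⊆ closure (⋃ α ∈ A, S.openCube δ (k + 1) α) := by
    intro w hw
    obtain ⟨b, ⟨hb, hb'⟩, hd⟩ := mem_openCube.1 hw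
    rcases Relation.ReflTransGen.cases_tail hb' with h | ⟨⟨l, α⟩, hc, hα, h⟩
    · -- The ball around the center of the cube is covered by children, which are near the center.
      subst h
      obtain ⟨α, hα, hwα⟩ := exists_mem_closedCube hX h₀ h₁ hS (k + 1) w
      have h1 := dist_le_of_mem_closedCube h₀ h₁ hS.parents hwα
      have hpar : S.par (k + 1) α = σ := by
        refine hS.parents.eq_of_near (k + 1) α hα σ (by simpa using hσ) ?_
        rw [add_sub_cancel_right]
        have := dist_triangle_left (S.ctr (k + 1) α) (S.ctr k σ) w
        dsimp only at hd
        nlinarith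
      exact closure_mono (Set.subset_biUnion_of_mem (show α ∈ A from ⟨hα, hpar⟩)) hwα
    · obtain ⟨h1, h2⟩ := Prod.mk.inj h
      dsimp only at h1 h2 hα
      obtain rfl : l = k + 1 := by omega
      exact subset_closure (Set.mem_iUnion₂.2 ⟨α, ⟨hα, h2.symm⟩,
        mem_openCube.2 ⟨b, ⟨hb, hc⟩, hd⟩⟩)
  have hx' := closure_minimal hsub isClosed_closure hx
  rw [hA.closure_biUnion] at hx'
  obtain ⟨α, hα, h⟩ := Set.mem_iUnion₂.1 hx'
  exact ⟨α, hα.1, hα.2, h⟩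

/-! ### Half-open cubes -/

theorem halfOpenCubeNat_subset_closedCube (S : PointSystem X) (δ : ℝ) (n : ℕ) (α : ℕ) :
    S.halfOpenCubeNat δ n α ⊆ S.closedCube δ n α := by
  cases n with
  | zero => exact fun x hx => hx.1
  | succ n => exact fun x hx => by simpa using hx.1.2

theorem cube_ofNat (S : PointSystem X) (δ : ℝ) (n : ℕ) (α : ℕ) :
    S.cube δ (n : ℤ) α = S.halfOpenCubeNat δ n α := rfl

theorem mem_cube_negSucc {S : PointSystem X} {δ : ℝ} {n α : ℕ} {x : X} :
    x ∈ S.cube δ (Int.negSucc n) α ↔ ∃ β, (β ∈ S.idx 0 ∧ S.Below (0, β) (Int.negSucc n, α)) ∧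
      x ∈ S.halfOpenCubeNat δ 0 β := by
  simp [cube]

theorem cube_subset_closedCube (S : PointSystem X) (δ : ℝ) (k : ℤ) (α : ℕ) :
    S.cube δ k α ⊆ S.closedCube δ k α := by
  cases k with
  | ofNat n => exact S.halfOpenCubeNat_subset_closedCube δ n α
  | negSucc n =>
    intro x hx
    obtain ⟨β, ⟨-, hβ⟩, hx⟩ := mem_cube_negSucc.1 hx
    exact closedCube_mono δ hβ (S.halfOpenCubeNat_subset_closedCube δ 0 β hx)

theorem cube_subset_cube_par {S : PointSystem X} (δ : ℝ) {k : ℤ} {α : ℕ} (hα : α ∈ S.idx k) :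
    S.cube δ k α ⊆ S.cube δ (k - 1) (S.par k α) := by
  rcases k with (_ | n) | n
  · exact fun x hx => mem_cube_negSucc.2 ⟨α, ⟨hα, below_par hα⟩, hx⟩
  · intro x hx
    have e : (Int.ofNat (n + 1) : ℤ) - 1 = (n : ℤ) := by simp
    rw [e, cube_ofNat]
    exact hx.1.1
  · intro x hx
    obtain ⟨β, ⟨hβ, hb⟩, hx⟩ := mem_cube_negSucc.1 hx
    exact mem_cube_negSucc.2 ⟨β, ⟨hβ, hb.trans (below_par hα)⟩, hx⟩

theorem cube_mono {S : PointSystem X} (δ : ℝ) {a b : ℤ × ℕ} (h : S.Below b a) :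
    S.cube δ b.1 b.2 ⊆ S.cube δ a.1 a.2 := by
  induction h with
  | refl => exact subset_rfl
  | tail _ h ih =>
    obtain ⟨h, rfl⟩ := h
    exact ih.trans (cube_subset_cube_par δ h)

/-- The half-open cubes of one nonnegative generation are disjoint: those with the same parent by
construction, the others because their parents are disjoint. -/
theorem halfOpenCubeNat_index_unique {S : PointSystem X} {near far δ : ℝ}
    (hS : S.IsParentRule near far δ) {n : ℕ} {α β : ℕ} (hα : α ∈ S.idx n)
    (hβ : β ∈ S.idx n) {x : X} (hxα : x ∈ S.halfOpenCubeNat δ n α)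
    (hxβ : x ∈ S.halfOpenCubeNat δ n β) : α = β := by
  induction n generalizing α β with
  | zero =>
    rcases lt_trichotomy α β with h | h | h
    · exact absurd (Set.mem_iUnion₂.2 ⟨α, ⟨hα, h⟩, hxα.1⟩) hxβ.2
    · exact h
    · exact absurd (Set.mem_iUnion₂.2 ⟨β, ⟨hβ, h⟩, hxβ.1⟩) hxα.2
  | succ n ih =>
    push_cast at hα hβ
    have hp : S.par (n + 1) α = S.par (n + 1) β :=
      ih (by simpa using hS.mem _ α hα) (by simpa using hS.mem _ β hβ) hxα.1.1 hxβ.1.1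
    rcases lt_trichotomy α β with h | h | h
    · exact absurd (Set.mem_iUnion₂.2 ⟨α, ⟨hα, h, hp⟩, hxα.1.2⟩) hxβ.2
    · exact h
    · exact absurd (Set.mem_iUnion₂.2 ⟨β, ⟨hβ, h, hp.symm⟩, hxβ.1.2⟩) hxα.2

theorem cube_index_unique {S : PointSystem X} {near far δ : ℝ}
    (hS : S.IsParentRule near far δ) {k : ℤ} {α β : ℕ} (hα : α ∈ S.idx k)
    (hβ : β ∈ S.idx k) {x : X} (hxα : x ∈ S.cube δ k α) (hxβ : x ∈ S.cube δ k β) : α = β := by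
  cases k with
  | ofNat n => exact halfOpenCubeNat_index_unique hS hα hβ hxα hxβ
  | negSucc n =>
    obtain ⟨a, ⟨ha, ha'⟩, hxa⟩ := mem_cube_negSucc.1 hxα
    obtain ⟨b, ⟨hb, hb'⟩, hxb⟩ := mem_cube_negSucc.1 hxβ
    obtain rfl := halfOpenCubeNat_index_unique (n := 0) hS ha hb hxa hxb
    exact (Prod.mk.inj (Below.unique ha' hb' rfl)).2

theorem exists_min_of_mem {P : ℕ → Prop} (h : ∃ α, P α) : ∃ α, P α ∧ ∀ β < α, ¬ P β := by
  classical
  exact ⟨Nat.find h, Nat.find_spec h, fun β hβ => Nat.find_min h hβ⟩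

theorem exists_mem_halfOpenCubeNat {N : ℕ} (hX : GeometricallyDoubling X N) {S : PointSystem X}
    {δ : ℝ} (h₀ : 0 < δ) (h₁ : δ ≤ 1 / 1000) (hS : S.IsDyadicSystem δ) (n : ℕ) (x : X) :
    ∃ α ∈ S.idx n, x ∈ S.halfOpenCubeNat δ n α := by
  induction n with
  | zero =>
    obtain ⟨α, ⟨hα, hx⟩, hmin⟩ := exists_min_of_mem (exists_mem_closedCube hX h₀ h₁ hS 0 x)
    refine ⟨α, hα, hx, fun h => ?_⟩
    obtain ⟨β, ⟨hβ, hlt⟩, hxβ⟩ := Set.mem_iUnion₂.1 h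
    exact hmin β hlt ⟨hβ, hxβ⟩
  | succ n ih =>
    obtain ⟨σ, hσ, hxσ⟩ := ih
    obtain ⟨α, ⟨hα, hp, hx⟩, hmin⟩ := exists_min_of_mem (exists_child_mem_closedCube hX h₀ h₁ hS hσ
      (S.halfOpenCubeNat_subset_closedCube δ n σ hxσ))
    refine ⟨α, by simpa using hα, ⟨by rwa [hp], hx⟩, fun h => ?_⟩
    obtain ⟨β, ⟨hβ, hlt, hp'⟩, hxβ⟩ := Set.mem_iUnion₂.1 h
    exact hmin β hlt ⟨hβ, hp'.trans hp, hxβ⟩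

theorem exists_mem_cube {N : ℕ} (hX : GeometricallyDoubling X N) {S : PointSystem X}
    {δ : ℝ} (h₀ : 0 < δ) (h₁ : δ ≤ 1 / 1000) (hS : S.IsDyadicSystem δ) (k : ℤ) (x : X) :
    ∃ α ∈ S.idx k, x ∈ S.cube δ k α := by
  cases k with
  | ofNat n => exact exists_mem_halfOpenCubeNat hX h₀ h₁ hS n x
  | negSucc n =>
    obtain ⟨β, hβ, hx⟩ := exists_mem_halfOpenCubeNat hX h₀ h₁ hS 0 x
    obtain ⟨α, hα, hb⟩ := exists_ancestor (l := 0) (k := Int.negSucc n) hS.parents hβ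
      (Int.negSucc_lt_zero n).le
    exact ⟨α, hα, mem_cube_negSucc.2 ⟨β, ⟨hβ, hb⟩, hx⟩⟩

/-- Around a point close to a center, small balls do not meet the boundary of the cube: all points
of generation `j + 1` nearby are so close to this center that it is their common parent. -/
theorem ball_subset_cube {N : ℕ} (hX : GeometricallyDoubling X N) {S : PointSystem X}
    {δ : ℝ} (h₀ : 0 < δ) (h₁ : δ ≤ 1 / 1000) (hS : S.IsDyadicSystem δ) {j : ℤ} {σ : ℕ}
    (hσ : σ ∈ S.idx j) {x : X} (hx : dist (S.ctr j σ) x < δ ^ (j + 1)) :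
    Metric.ball x (δ ^ (j + 1)) ⊆ S.cube δ j σ := by
  intro w hw
  rw [Metric.mem_ball] at hw
  have hj : (0 : ℝ) < δ ^ j := zpow_pos h₀ j
  have e : δ ^ (j + 1) = δ ^ j * δ := zpow_add_one₀ h₀.ne' j
  obtain ⟨τ, hτ, hwτ⟩ := exists_mem_cube hX h₀ h₁ hS j w
  obtain ⟨α, hα, rfl, hwα⟩ := exists_child_mem_closedCube hX h₀ h₁ hS hτ
    (S.cube_subset_closedCube δ j τ hwτ)
  have h1 := dist_le_of_mem_closedCube h₀ h₁ hS.parents hwα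
  have h2 := dist_triangle_left (S.ctr (j + 1) α) (S.ctr j σ) w
  have h3 := dist_triangle_right w (S.ctr j σ) x
  have : S.par (j + 1) α = σ := by
    refine hS.parents.eq_of_near (j + 1) α hα σ (by simpa using hσ) ?_
    rw [add_sub_cancel_right]
    nlinarith
  rwa [← this]

/-- A center of generation `j` close to the center of the cube `Q` keeps `Q` away from the
boundaries of all cubes of generations `m ≤ j`, as cubes are nested. -/
theorem good_at_of_near_center {N : ℕ} (hX : GeometricallyDoubling X N) {D S : PointSystem X}
    {δ : ℝ} (h₀ : 0 < δ) (h₁ : δ ≤ 1 / 1000) (hD : D.IsDyadicSystem δ) (hS : S.IsDyadicSystem δ)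
    {k m j : ℤ} {α β σ : ℕ} (hσ : σ ∈ S.idx j)
    (hx : dist (S.ctr j σ) (D.ctr k α) < δ ^ (j + 1)) (hmj : m ≤ j) (hβ : β ∈ S.idx m) {ρ : ℝ}
    (hkρ : δ ^ k ≤ ρ) (hρ : 6 * ρ ≤ δ ^ (j + 1)) :
    ENNReal.ofReal ρ ≤ setEDist (D.cube δ k α) (S.cube δ m β) ∨
      ENNReal.ofReal ρ ≤ setEDist (D.cube δ k α) (S.cube δ m β)ᶜ := by
  have hball := ball_subset_cube hX h₀ h₁ hS hσ hx
  obtain ⟨τ, hτ, hb⟩ := exists_ancestor hS.parents hσ hmj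
  have hball' := hball.trans (cube_mono δ hb)
  have key : ∀ B : Set X, B ∩ S.cube δ m τ = ∅ →
      ENNReal.ofReal ρ ≤ setEDist (D.cube δ k α) B := by
    intro B hB
    refine le_iInf₂ fun a ha => le_iInf₂ fun b hb => ?_
    rw [edist_dist]
    refine ENNReal.ofReal_le_ofReal ?_
    by_contra hlt
    have h1 := dist_le_of_mem_closedCube h₀ h₁ hD.parents (D.cube_subset_closedCube δ k α ha)
    have h2 := dist_triangle_left b (D.ctr k α) a
    have : b ∈ B ∩ S.cube δ m τ := ⟨hb, hball' (Metric.mem_ball.2 (by linarith))⟩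
    rw [hB] at this
    exact this
  by_cases h : β = τ
  · subst h
    exact .inr (key _ (Set.compl_inter_self _))
  · refine .inl (key _ (Set.eq_empty_of_forall_notMem fun w hw => h ?_))
    exact cube_index_unique hS.parents hβ hτ hw.1 hw.2

end PointSystem

namespace PointSystem

variable {X : Type u}

/-! ### The random points -/

theorem newPoint_of_mem {S : PointSystem X} (ω : S.Choice) {k : ℤ} {α : ℕ} (h : α ∈ S.idx k) :
    S.newPoint ω k α = S.ctr (k + 1) (ω ⟨(k, α), h⟩) := by
  rw [newPoint, dif_pos h]

variable [MetricSpace X]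

theorem survives_iff {S : PointSystem X} {δ : ℝ} {ω : S.Choice} {k : ℤ} {α : ℕ} :
    S.Survives δ ω k α ↔ α ∈ S.idx k ∧ ∀ β < α, S.Survives δ ω k β →
      ¬ dist (S.newPoint ω k β) (S.newPoint ω k α) < δ ^ k / 4 := by
  rw [Survives]

theorem dist_newPoint_lt {S : PointSystem X} {δ : ℝ} (hS : S.IsReferenceSystem δ) (ω : S.Choice)
    {k : ℤ} {α : ℕ} (h : α ∈ S.idx k) : dist (S.newPoint ω k α) (S.ctr k α) < δ ^ k := by
  rw [newPoint_of_mem ω h]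
  obtain ⟨hb, hp⟩ := (ω ⟨(k, α), h⟩).2
  have := hS.parents.dist_lt _ _ hb
  rwa [hp, one_mul, add_sub_cancel_right] at this

theorem isDyadicSystem_randomSystem {S : PointSystem X} {δ : ℝ} (h₀ : 0 < δ)
    (hS : S.IsReferenceSystem δ) {ω : S.Choice} {p : ℤ → ℕ → ℕ}
    (hp : (S.randomSystem δ ω p).IsParentRule (1 / 16) 4 δ) :
    (S.randomSystem δ ω p).IsDyadicSystem δ where
  separated := by
    have key : ∀ k α β, S.Survives δ ω k α → S.Survives δ ω k β → α < β →
        δ ^ k / 8 ≤ dist (S.newPoint ω k α) (S.newPoint ω k β) := by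
      intro k α β hα hβ h
      have := not_lt.1 ((survives_iff.1 hβ).2 α h hα)
      have hk : (0 : ℝ) < δ ^ k := zpow_pos h₀ k
      linarith
    intro k α hα β hβ hne
    rcases lt_or_gt_of_ne hne with h | h
    · exact key k α β hα hβ h
    · rw [dist_comm]
      exact key k β α hβ hα h
  covers := by
    intro k x
    have hk : (0 : ℝ) < δ ^ k := zpow_pos h₀ k
    obtain ⟨α, hα, hd⟩ := hS.maximal k x
    have h1 := dist_newPoint_lt hS ω hα
    have h2 := dist_triangle_right x (S.newPoint ω k α) (S.ctr k α)
    by_cases h : S.Survives δ ω k α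
    · exact ⟨α, h, show dist x (S.newPoint ω k α) < _ by linarith⟩
    · -- A point which was removed is close to a point which was kept.
      rw [survives_iff] at h
      push Not at h
      obtain ⟨β, -, hβ, hlt⟩ := h hα
      have h3 := dist_triangle_right x (S.newPoint ω k β) (S.newPoint ω k α)
      exact ⟨β, hβ, show dist x (S.newPoint ω k β) < _ by linarith⟩
  parents := hp

theorem exists_central_child {S : PointSystem X} {δ : ℝ} (h₀ : 0 < δ) (h₁ : δ ≤ 1 / 1000)
    (hS : S.IsReferenceSystem δ) (a : S.Node) :
    ∃ b : S.Child a, dist (S.ctr (a.1.1 + 1) b) (S.ctr a.1.1 a.1.2) < δ ^ (a.1.1 + 1) := by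
  obtain ⟨⟨k, α⟩, ha⟩ := a
  dsimp only at ha ⊢
  obtain ⟨β, hβ, hd⟩ := hS.maximal (k + 1) (S.ctr k α)
  have hk : (0 : ℝ) < δ ^ k := zpow_pos h₀ k
  have e : δ ^ (k + 1) = δ ^ k * δ := zpow_add_one₀ h₀.ne' k
  rw [dist_comm] at hd
  refine ⟨⟨β, hβ, hS.parents.eq_of_near (k + 1) β hβ α (by simpa using ha) ?_⟩, hd⟩
  rw [add_sub_cancel_right]
  nlinarith

/-- Fixing boundedly many choices in generation `j` forces a surviving center near `x`. A point
`z` of generation `j + 1` near `x` is picked by its parent, and all other points near `x` pick a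
child next to themselves. No such child is in conflict with `z`, because `z` is at distance at
least `δ ^ j / 2` from every point of generation `j` other than its parent. -/
theorem exists_favorable_choice {N : ℕ} (hX : GeometricallyDoubling X N) {S : PointSystem X}
    {δ : ℝ} (h₀ : 0 < δ) (h₁ : δ ≤ 1 / 1000) (hS : S.IsReferenceSystem δ) {n : ℕ}
    (hn : 6 ≤ δ * 2 ^ n) (x : X) (j : ℤ) :
    ∃ (T : Finset S.Node) (c : S.Choice), (∀ a ∈ T, a.1.1 = j) ∧ T.card ≤ N ^ n ∧
      ∀ ω : S.Choice, (∀ a ∈ T, ω a = c a) →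
        ∃ σ, S.Survives δ ω j σ ∧ dist (S.newPoint ω j σ) x < δ ^ (j + 1) := by
  classical
  have hj : (0 : ℝ) < δ ^ j := zpow_pos h₀ j
  have e : δ ^ (j + 1) = δ ^ j * δ := zpow_add_one₀ h₀.ne' j
  have he : δ ^ (j + 1) ≤ δ ^ j / 1000 := by nlinarith
  have h2n : (6 : ℝ) ≤ 2 ^ n := by nlinarith [pow_pos (two_pos (α := ℝ)) n]
  let A : Set S.Node := {a | a.1.1 = j ∧ dist (S.ctr j a.1.2) x < 3 * δ ^ j}
  obtain ⟨hA, hAc⟩ := hX.finite_and_ncard_le (fun a : S.Node => S.ctr j a.1.2) A x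
    (R := 3 * δ ^ j) (s := δ ^ j) n (by positivity) (by nlinarith)
    (by
      rintro ⟨⟨k, α⟩, ha⟩ ⟨rfl, -⟩ ⟨⟨l, β⟩, hb⟩ ⟨h, -⟩ hne
      dsimp only at h
      subst h
      refine hS.separated _ α ha β hb fun h => hne ?_
      subst h
      rfl)
    fun a ha => ha.2
  obtain ⟨β, hβ, hβx⟩ := hS.maximal (j + 1) x
  have hpar : S.par (j + 1) β ∈ S.idx j := by simpa using hS.parents.mem _ β hβ
  have hpd := hS.parents.dist_lt _ β hβ
  rw [add_sub_cancel_right, one_mul] at hpd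
  choose c₀ hc₀ using exists_central_child h₀ h₁ hS
  let a₀ : S.Node := ⟨(j, S.par (j + 1) β), hpar⟩
  let b₀ : S.Child a₀ := ⟨β, hβ, rfl⟩
  refine ⟨hA.toFinset, Function.update c₀ a₀ b₀, fun a ha => (hA.mem_toFinset.1 ha).1, ?_,
    fun ω hω => ⟨S.par (j + 1) β, ?_⟩⟩
  · rwa [← Set.ncard_eq_toFinset_card A hA]
  · have hω₀ : ω a₀ = b₀ := by
      have : a₀ ∈ hA.toFinset := by
        refine hA.mem_toFinset.2 ⟨rfl, ?_⟩
        have := dist_triangle_left (S.ctr j (S.par (j + 1) β)) x (S.ctr (j + 1) β)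
        rw [dist_comm x] at hβx
        change dist (S.ctr j (S.par (j + 1) β)) x < _
        linarith
      rw [hω a₀ this, Function.update_self]
    have hnew : S.newPoint ω j (S.par (j + 1) β) = S.ctr (j + 1) β := by
      rw [newPoint_of_mem ω hpar]
      change S.ctr (j + 1) (ω a₀) = _
      rw [hω₀]
    rw [hnew, dist_comm]
    refine ⟨survives_iff.2 ⟨hpar, fun τ hτ hsτ hlt => ?_⟩, hβx⟩
    rw [hnew] at hlt
    have hτj := (survives_iff.1 hsτ).1
    have hne : (⟨(j, τ), hτj⟩ : S.Node) ≠ a₀ := fun h => hτ.ne (congrArg (fun a => a.1.2) h)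
    by_cases hτA : (⟨(j, τ), hτj⟩ : S.Node) ∈ A
    · have h1 : S.newPoint ω j τ = S.ctr (j + 1) (c₀ ⟨(j, τ), hτj⟩) := by
        rw [newPoint_of_mem ω hτj, hω _ (hA.mem_toFinset.2 hτA), Function.update_of_ne hne]
      have h2 := hc₀ ⟨(j, τ), hτj⟩
      rw [h1] at hlt
      dsimp only at h2
      have h3 := dist_triangle_left (S.ctr (j + 1) β) (S.ctr j τ)
        (S.ctr (j + 1) (c₀ ⟨(j, τ), hτj⟩))
      refine hτ.ne' (hS.parents.eq_of_near (j + 1) β hβ τ (by simpa using hτj) ?_)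
      rw [add_sub_cancel_right]
      linarith
    · refine hτA ⟨rfl, ?_⟩
      change dist (S.ctr j τ) x < _
      have h1 := dist_newPoint_lt hS ω hτj
      have h2 := dist_triangle_left (S.ctr j τ) x (S.newPoint ω j τ)
      have h3 := dist_triangle (S.newPoint ω j τ) (S.ctr (j + 1) β) x
      rw [dist_comm x] at hβx
      linarith

theorem card_child_le {N : ℕ} (hX : GeometricallyDoubling X N) {S : PointSystem X}
    {δ : ℝ} (h₀ : 0 < δ) (hS : S.IsReferenceSystem δ) {n : ℕ} (hn : 6 ≤ δ * 2 ^ n)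
    (a : S.Node) : Nat.card (S.Child a) ≤ N ^ n := by
  obtain ⟨⟨k, α⟩, ha⟩ := a
  have hk : (0 : ℝ) < δ ^ k := zpow_pos h₀ k
  have e : δ ^ (k + 1) = δ ^ k * δ := zpow_add_one₀ h₀.ne' k
  obtain ⟨-, h⟩ := hX.finite_and_ncard_le (S.ctr (k + 1))
    {β | β ∈ S.idx (k + 1) ∧ S.par (k + 1) β = α} (S.ctr k α) (R := δ ^ k) (s := δ ^ (k + 1)) n hk
    (by rw [e, mul_assoc]; nlinarith) (fun i hi j hj => hS.separated _ i hi.1 j hj.1)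
    (fun i hi => by
      have := hS.parents.dist_lt _ i hi.1
      rwa [hi.2, one_mul, add_sub_cancel_right] at this)
  exact h

/-! ### Independence of the generations -/

/-- Cylinder events over disjoint finite sets of coordinates are independent under a product
measure; so the probability that all of them fail is a product. -/
theorem infinitePi_biInter_compl_pi_le {ι κ : Type*} {Y : ι → Type*}
    [∀ i, MeasurableSpace (Y i)] (μ : ∀ i, Measure (Y i)) [∀ i, IsProbabilityMeasure (μ i)]
    (T : κ → Finset ι) (hT : Pairwise (Function.onFun Disjoint T)) (A : ∀ i, Set (Y i))
    (hA : ∀ i, MeasurableSet (A i)) {q : ENNReal} (hq : q ≤ 1) {M : ℕ}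
    (hTq : ∀ j, ∀ i ∈ T j, q ≤ μ i (A i)) (hM : ∀ j, (T j).card ≤ M) (J : Finset κ) :
    Measure.infinitePi μ (⋂ j ∈ J, ((T j : Set ι).pi A)ᶜ) ≤ (1 - q ^ M) ^ J.card := by
  classical
  have hmeas : ∀ j, MeasurableSet ((T j : Set ι).pi A) := fun j =>
    MeasurableSet.pi (T j).countable_toSet fun i _ => hA i
  have hind : iIndepSet (fun j => (T j : Set ι).pi A) (Measure.infinitePi μ) := by
    rw [iIndepSet_iff_meas_biInter hmeas]
    intro s
    have : ⋂ j ∈ s, (T j : Set ι).pi A = ((s.biUnion T : Finset ι) : Set ι).pi A := by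
      ext ω
      simp only [Set.mem_iInter, Set.mem_pi, Finset.mem_coe, Finset.mem_biUnion]
      exact ⟨fun h i ⟨j, hj, hi⟩ => h j hj i hi, fun h j hj i hi => h i ⟨j, hj, hi⟩⟩
    rw [this, Measure.infinitePi_pi μ (fun i _ => hA i),
      Finset.prod_biUnion fun i _ j _ hij => hT hij]
    exact Finset.prod_congr rfl fun j _ => (Measure.infinitePi_pi μ fun i _ => hA i).symm
  have hcompl := (iIndepSet_iff _ _).1 hind J (f := fun j => ((T j : Set ι).pi A)ᶜ)
    fun j _ => (MeasurableSpace.measurableSet_generateFrom (Set.mem_singleton _)).compl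
  rw [hcompl, ← Finset.prod_const]
  refine Finset.prod_le_prod' fun j _ => ?_
  rw [prob_compl_eq_one_sub (hmeas j), Measure.infinitePi_pi μ fun i _ => hA i]
  refine tsub_le_tsub_left ?_ 1
  calc q ^ M ≤ q ^ (T j).card := pow_le_pow_right_of_le_one' hq (hM j)
    _ = ∏ i ∈ T j, q := (Finset.prod_const q).symm
    _ ≤ ∏ i ∈ T j, μ i (A i) := Finset.prod_le_prod' (hTq j)

theorem inv_le_uniformOn_singleton {Ω : Type*} [MeasurableSpace Ω] [MeasurableSingletonClass Ω]
    [Finite Ω] {M : ℕ} (hM : Nat.card Ω ≤ M) (c : Ω) :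
    (M : ENNReal)⁻¹ ≤ uniformOn (Set.univ : Set Ω) {c} := by
  have := Fintype.ofFinite Ω
  rw [uniformOn_univ, Measure.count_singleton, one_div]
  rw [Nat.card_eq_fintype_card] at hM
  exact ENNReal.inv_le_inv.2 (by exact_mod_cast hM)

/-- The probability that none of the generations in `J` has a center near `x`: each of
them has one with probability at least `(1 / M) ^ M`, independently of the others. -/
theorem choiceLaw_no_near_center_le {N : ℕ} (hX : GeometricallyDoubling X N) {S : PointSystem X}
    {δ : ℝ} (h₀ : 0 < δ) (h₁ : δ ≤ 1 / 1000) (hS : S.IsReferenceSystem δ) {n M : ℕ}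
    (hn : 6 ≤ δ * 2 ^ n) (hM : N ^ n ≤ M) (hM₀ : 1 ≤ M) (x : X) (J : Finset ℤ) :
    choiceLaw hX h₀ h₁ hS {ω | ∀ j ∈ J, ¬ ∃ σ, S.Survives δ ω j σ ∧
        dist (S.newPoint ω j σ) x < δ ^ (j + 1)} ≤ (1 - (M : ENNReal)⁻¹ ^ M) ^ J.card := by
  choose T c hTj hTc hT using exists_favorable_choice hX h₀ h₁ hS hn x
  have : ∀ a, Finite (S.Child a) := child_finite hX h₀ hS
  have : ∀ a, Nonempty (S.Child a) := child_nonempty h₀ h₁ hS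
  have : ∀ a, IsProbabilityMeasure (uniformOn (Set.univ : Set (S.Child a))) := fun _ =>
    isProbabilityMeasure_uniformOn Set.finite_univ Set.univ_nonempty
  refine le_trans (measure_mono ?_) (infinitePi_biInter_compl_pi_le
    (fun a => uniformOn (Set.univ : Set (S.Child a))) T ?_ (fun a => {c a.1.1 a})
    (fun a => measurableSet_singleton _) ?_ (fun j a _ => inv_le_uniformOn_singleton
      ((card_child_le hX h₀ hS hn a).trans hM) _) (fun j => (hTc j).trans hM) J)
  · intro ω hω
    refine Set.mem_iInter₂.2 fun j hj hmem => hω j hj (hT j ω fun a ha => ?_)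
    have := hmem a ha
    rw [Set.mem_singleton_iff, hTj j a ha] at this
    exact this
  · intro i j hij
    refine Finset.disjoint_left.2 fun a ha hb => hij ?_
    rw [← hTj i a ha, hTj j a hb]
  · exact ENNReal.inv_le_one.2 (by exact_mod_cast hM₀)

/-! ### The probability of bad cubes -/

/-- If the cube `(k, α)` is bad because of a cube of generation `m = k - r - i`, then none of the
generations `j` in a window of about `(k - m) * γ` generations starting at `m` has a center close
to the center of `(k, α)`. The window consists of the `j ≥ m` for which `δ ^ (j + 1)` is at least
`1 / δ` times the threshold `ℓ(Q) ^ γ * ℓ(R) ^ (1 - γ)`; it may be empty. -/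
theorem exists_gap_of_isBad {N : ℕ} (hX : GeometricallyDoubling X N) {D S : PointSystem X}
    {δ γ : ℝ} (h₀ : 0 < δ) (h₁ : δ ≤ 1 / 1000) (hγ₁ : γ < 1)
    (hD : D.IsDyadicSystem δ) (hS : S.IsDyadicSystem δ) {r : ℕ} {k : ℤ} {α : ℕ}
    (hbad : D.IsBad S δ γ r k α) :
    ∃ i : ℕ, ∀ j ∈ Finset.Ico (k - r - i) (k - r - i + (⌊(r + i : ℝ) * γ - 1⌋₊ : ℤ)),
      ¬ ∃ σ ∈ S.idx j, dist (S.ctr j σ) (D.ctr k α) < δ ^ (j + 1) := by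
  have hδ1 : δ < 1 := by linarith
  rw [IsBad, IsGood] at hbad
  push Not at hbad
  obtain ⟨m, β, hβ, hm, h1, h2⟩ := hbad
  rw [← zpow_natCast, ← zpow_add₀ h₀.ne', zpow_le_zpow_iff_right_of_lt_one₀ h₀ hδ1] at hm
  obtain ⟨i, hi⟩ := Int.eq_ofNat_of_zero_le (a := k - r - m) (by omega)
  obtain rfl : m = k - r - i := by omega
  refine ⟨i, fun j hj => ?_⟩
  rintro ⟨σ, hσ, hd⟩
  obtain ⟨hmj, hjL⟩ := Finset.mem_Ico.1 hj
  obtain ⟨t, ht⟩ := Int.eq_ofNat_of_zero_le (sub_nonneg.2 hmj)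
  have hri : (0 : ℝ) ≤ r + i := by positivity
  have htL : ((t : ℝ)) + 1 ≤ (r + i : ℝ) * γ - 1 := by
    have h : t + 1 ≤ ⌊(r + i : ℝ) * γ - 1⌋₊ := by omega
    have hpos : 0 < ⌊(r + i : ℝ) * γ - 1⌋₊ := by omega
    have := (Nat.le_floor_iff (Nat.pos_of_floor_pos hpos).le).1 h
    exact_mod_cast this
  -- All distances involved are powers of `δ`.
  have hρ : (δ ^ k) ^ γ * (δ ^ (k - r - i : ℤ)) ^ (1 - γ) =
      δ ^ ((k : ℝ) * γ + ((k : ℝ) - r - i) * (1 - γ)) := by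
    rw [← Real.rpow_intCast, ← Real.rpow_intCast, ← Real.rpow_mul h₀.le, ← Real.rpow_mul h₀.le,
      ← Real.rpow_add h₀]
    push_cast
    rfl
  have hkρ : δ ^ k ≤ (δ ^ k) ^ γ * (δ ^ (k - r - i : ℤ)) ^ (1 - γ) := by
    rw [hρ, ← Real.rpow_intCast]
    refine Real.rpow_le_rpow_of_exponent_ge h₀ hδ1.le ?_
    nlinarith
  have hρj : 6 * ((δ ^ k) ^ γ * (δ ^ (k - r - i : ℤ)) ^ (1 - γ)) ≤ δ ^ (j + 1) := by
    rw [hρ]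
    have hj' : ((j + 1 : ℤ) : ℝ) + 1 ≤ (k : ℝ) * γ + ((k : ℝ) - r - i) * (1 - γ) := by
      have : (j : ℝ) = (k : ℝ) - r - i + t := by
        have : j = k - r - i + t := by omega
        exact_mod_cast this
      push_cast
      rw [this]
      nlinarith
    have h3 := Real.rpow_le_rpow_of_exponent_ge h₀ hδ1.le hj'
    rw [Real.rpow_add_one h₀.ne', Real.rpow_intCast] at h3
    have : (0 : ℝ) < δ ^ (j + 1) := zpow_pos h₀ _
    nlinarith
  rcases good_at_of_near_center hX h₀ h₁ hD hS hσ hd hmj hβ hkρ hρj with h | h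
  · exact absurd h h1.not_ge
  · exact absurd h h2.not_ge

/-- Summing the geometric series over all generations that may make a cube bad. -/
theorem choiceLaw_isBad_le {N : ℕ} (hX : GeometricallyDoubling X N) {D S : PointSystem X}
    {δ γ η : ℝ} (h₀ : 0 < δ) (h₁ : δ ≤ 1 / 1000) (hγ₀ : 0 < γ) (hγ₁ : γ < 1) (hη : 0 < η)
    (hD : D.IsDyadicSystem δ) (hS : S.IsReferenceSystem δ) {n M : ℕ}
    (hn : 6 ≤ δ * 2 ^ n) (hM : N ^ n ≤ M) (hM₀ : 1 ≤ M)
    (hMη : (1 - (M : ENNReal)⁻¹ ^ M) ≤ ENNReal.ofReal (δ ^ η))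
    {p : S.Choice → ℤ → ℕ → ℕ} (hp : S.IsParentChoice δ p) (r : ℕ) (k : ℤ) (α : ℕ) :
    choiceLaw hX h₀ h₁ hS {ω | D.IsBad (S.randomSystem δ ω (p ω)) δ γ r k α} ≤
      ENNReal.ofReal (δ ^ (-(2 * η)) / (1 - δ ^ (γ * η)) * δ ^ ((r : ℝ) * γ * η)) := by
  have hδ1 : δ < 1 := by linarith
  let J : ℕ → Finset ℤ := fun i =>
    Finset.Ico (k - r - i) (k - r - i + (⌊(r + i : ℝ) * γ - 1⌋₊ : ℤ))
  have hsub : {ω | D.IsBad (S.randomSystem δ ω (p ω)) δ γ r k α} ⊆ ⋃ i : ℕ,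
      {ω | ∀ j ∈ J i, ¬ ∃ σ, S.Survives δ ω j σ ∧
        dist (S.newPoint ω j σ) (D.ctr k α) < δ ^ (j + 1)} := fun ω hω =>
    Set.mem_iUnion.2 (exists_gap_of_isBad hX h₀ h₁ hγ₁ hD
      (isDyadicSystem_randomSystem h₀ hS (hp.rule ω)) hω)
  have hterm : ∀ i : ℕ, choiceLaw hX h₀ h₁ hS {ω | ∀ j ∈ J i, ¬ ∃ σ, S.Survives δ ω j σ ∧
        dist (S.newPoint ω j σ) (D.ctr k α) < δ ^ (j + 1)} ≤
      ENNReal.ofReal (δ ^ (-(2 * η)) * δ ^ ((r : ℝ) * γ * η) * (δ ^ (γ * η)) ^ i) := by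
    intro i
    refine (choiceLaw_no_near_center_le hX h₀ h₁ hS hn hM hM₀ _ _).trans ?_
    refine (pow_le_pow_left₀ zero_le hMη _).trans ?_
    rw [← ENNReal.ofReal_pow (by positivity)]
    refine ENNReal.ofReal_le_ofReal ?_
    rw [← Real.rpow_natCast, ← Real.rpow_natCast, ← Real.rpow_mul h₀.le, ← Real.rpow_mul h₀.le,
      ← Real.rpow_add h₀, ← Real.rpow_add h₀]
    refine Real.rpow_le_rpow_of_exponent_ge h₀ hδ1.le ?_
    have hcard : (J i).card = ⌊(r + i : ℝ) * γ - 1⌋₊ := by simp [J]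
    rw [hcard]
    have := Nat.lt_floor_add_one ((r + i : ℝ) * γ - 1)
    nlinarith
  have hx : δ ^ (γ * η) < 1 := Real.rpow_lt_one h₀.le hδ1 (by positivity)
  have hx₀ : 0 ≤ δ ^ (γ * η) := by positivity
  calc _ ≤ _ := measure_mono hsub
    _ ≤ _ := measure_iUnion_le _
    _ ≤ ∑' i : ℕ, ENNReal.ofReal
          (δ ^ (-(2 * η)) * δ ^ ((r : ℝ) * γ * η) * (δ ^ (γ * η)) ^ i) :=
        ENNReal.tsum_le_tsum hterm
    _ = ENNReal.ofReal (∑' i : ℕ, δ ^ (-(2 * η)) * δ ^ ((r : ℝ) * γ * η) * (δ ^ (γ * η)) ^ i) :=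
        (ENNReal.ofReal_tsum_of_nonneg (fun i => by positivity)
          ((summable_geometric_of_lt_one hx₀ hx).mul_left _)).symm
    _ ≤ _ := by
        rw [tsum_mul_left, tsum_geometric_of_lt_one hx₀ hx]
        refine ENNReal.ofReal_le_ofReal (le_of_eq ?_)
        ring

end PointSystem

theorem mainTheorem2 (N : ℕ) (δ : ℝ) (hδ₀ : 0 < δ) (hδ₁ : δ ≤ 1 / 1000) :
    ∃ η : ℝ, 0 < η ∧ ∀ γ : ℝ, 0 < γ → γ < 1 → ∃ C : ℝ, 0 < C ∧
      ∀ (X : Type u) [MetricSpace X] (hX : GeometricallyDoubling X N)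
        (D : PointSystem X) (_ : D.IsDyadicSystem δ)
        (S : PointSystem X) (hS : S.IsReferenceSystem δ)
        (p : S.Choice → ℤ → ℕ → ℕ) (_ : S.IsParentChoice δ p)
        (r : ℕ) (k : ℤ) (α : ℕ) (_ : α ∈ D.idx k),
        PointSystem.choiceLaw hX hδ₀ hδ₁ hS
            {ω | D.IsBad (S.randomSystem δ ω (p ω)) δ γ r k α} ≤
          ENNReal.ofReal (C * δ ^ ((r : ℝ) * γ * η)) := by
  have hδ1 : δ < 1 := by linarith
  obtain ⟨n, hn⟩ := pow_unbounded_of_one_lt (6 / δ) (one_lt_two (α := ℝ))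
  rw [div_lt_iff₀' hδ₀] at hn
  -- The summand `2` makes the probability `q` of a favorable choice differ from `1`.
  set M : ℕ := N ^ n + 2 with hM
  have hM2 : (2 : ℝ) ≤ M := by exact_mod_cast (by omega : 2 ≤ M)
  set q : ℝ := (M : ℝ)⁻¹ ^ M with hq
  have hq₀ : 0 < q := by positivity
  have hq₁ : q < 1 := pow_lt_one₀ (by positivity) (inv_lt_one_of_one_lt₀ (by linarith)) (by omega)
  have hlog : Real.log δ < 0 := Real.log_neg hδ₀ hδ1
  have hη : 0 < Real.log (1 - q) / Real.log δ :=
    div_pos_of_neg_of_neg (Real.log_neg (by linarith) (by linarith)) hlog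
  refine ⟨Real.log (1 - q) / Real.log δ, hη, fun γ hγ₀ hγ₁ => ⟨_, ?_,
    fun X _ hX D hD S hS p hp r k α _ => PointSystem.choiceLaw_isBad_le hX hδ₀ hδ₁ hγ₀ hγ₁ hη hD hS
      hn.le (by omega) (by omega : 1 ≤ M) ?_ hp r k α⟩⟩
  · have := Real.rpow_lt_one hδ₀.le hδ1 (mul_pos hγ₀ hη)
    exact div_pos (by positivity) (by linarith)
  · have hpow : δ ^ (Real.log (1 - q) / Real.log δ) = 1 - q := by
      rw [Real.rpow_def_of_pos hδ₀, mul_div_cancel₀ _ hlog.ne, Real.exp_log (by linarith)]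
    rw [hpow, ENNReal.ofReal_sub _ hq₀.le, ENNReal.ofReal_one, hq,
      ENNReal.ofReal_pow (by positivity), ENNReal.ofReal_inv_of_pos (by linarith),
      ENNReal.ofReal_natCast]
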